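/- **Definitions.** Write $[A,B]=AB-BA$ and $\{A,B\}=AB+BA$. The rational degenerate Sklyanin algebra $\mathfrak{sK}_r$ is the unital associative $\mathbb{C}$-algebra with generators $S_0,S_3,S_+,S_-$ and relations $$[S_0,S_-]=-2\{S_-,S_-\},\qquad [S_0,S_+]=16\{S_3,S_-\}-16\{S_-,S_-\}+2\{S_+,S_-\}-4\{S_3,S_3\},$$ $$[S_+,S_-]=2\{S_0,S_3\},\qquad [S_0,S_3]=2\{S_3,S_-\}-8\{S_-,S_-\},\qquad [S_3,S_\pm]=\pm\{S_0,S_\pm\}.$$ With $(z)_k=z(z+1)\cdots(z+k-1)$, the Wilson polynomials are $$W_n(x^2|a,b,c,d)=(a+b)_n(a+c)_n(a+d)_n\;{}_4F_3\!\left({-n,\;n+a+b+c+d-1,\;a+ix,\;a-ix\atop a+b,\;a+c,\;a+d};1\right)$$ $$=\sum_{k=0}^n\frac{(-n)_k(n+a+b+c+d-1)_k}{k!}\,(a+b+k)_{n-k}(a+c+k)_{n-k}(a+d+k)_{n-k}\,\prod_{j=0}^{k-1}\big(x^2+(a+j)^2\big),$$ where the last expression, a polynomial in $x^2$, is used for all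 complex parameters. The rescaled Wilson polynomials are $\tilde W_n(x^2|a,b,c,d)=W_n(-x^2/4\,|\,a,b,c,d)$. **Proposition.** Let $a,b,c,d>0$ be real with $a+b\neq c+d$. Let $e_1,e_2,e_3,e_4$ be the elementary symmetric polynomials in $a,b,c,d$, and put $$\sigma=(a+b-c-d)^{-1},\quad \alpha=\tfrac12e_1^2-\tfrac43e_2,\quad \beta=-e_1^3+4e_1e_2-8e_3,\quad \xi=\tfrac1{16}\left(1-2e_1^2+e_1^4-256e_4\right).$$ Then the polynomials $\tilde W_n(x^2|a,b,c,d)$, $n\ge0$, form a basis of the space $\mathcal P$ of complex polynomials in $x^2$. Abbreviate $$\tilde W_n=\tilde W_n(x^2|a,b,c,d),\qquad A_n=\tilde W_n(x^2|a-\tfrac12,b-\tfrac12,c+\tfrac12,d+\tfrac12),\qquad B_n=\tilde W_n(x^2|a+\tfrac12,b+\tfrac12,c-\tfrac12,d-\tfrac12),$$ $$D_{n-1}=\tilde W_{n-1}(x^2|a+\tfrac12,b+\tfrac12,c+\tfrac12,d+\tfrac12),\qquad E_{n+1}=\tilde W_{n+1}(x^2|a-\tfrac12,b-\tfrac12,c-\tfrac12,d-\tfrac12)$$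 (for $n=0$ the terms with $D_{n-1}$ below have coefficient $0$ and are omitted). There is exactly one representation (unital algebra homomorphism) $\mathfrak{sK}_r\to\mathrm{End}_{\mathbb C}(\mathcal P)$ such that for all $n\ge0$ $$S_0\cdot\tilde W_n=4\sigma(n+c+d-1)B_n+\big(4\sigma(ab-cd)-e_1\big)n(n+e_1-1)D_{n-1}-4\sigma(n+a+b-1)A_n,$$ $$S_3\cdot\tilde W_n=-4(n+a+b-1)A_n+\tfrac12\big(8(ab+cd)-e_1^2-1\big)n(n+e_1-1)D_{n-1}-4(n+c+d-1)B_n,$$ $$S_-\cdot\tilde W_n=-\tfrac12n(n+e_1-1)D_{n-1},$$ $$S_+\cdot\tilde W_n=128\,E_{n+1}+8(6\alpha-1+2\beta\sigma)(n+a+b-1)A_n+8(6\alpha-1-2\beta\sigma)(n+c+d-1)B_n$$ $$\qquad\qquad+8\big[(1-6\alpha)(ab+cd)-2\beta\sigma(ab-cd)+\xi\big]n(n+e_1-1)D_{n-1}.$$ -/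

import Mathlib

namespace RationalSklyanin

open Polynomial

/-- The Pochhammer symbol `(z)_k = z (z + 1) ⋯ (z + k - 1)`. -/
noncomputable def poch (z : ℂ) (k : ℕ) : ℂ := (ascPochhammer ℂ k).eval z

/-- The Wilson polynomial `W_n(y | a, b, c, d)`, as a polynomial in `y = x²`.  The prefactor
`(a+b)_n (a+c)_n (a+d)_n` is absorbed in the terms of the hypergeometric sum, by
`(u)_n / (u)_k = (u + k)_{n-k}`, so that the definition makes sense for all parameters, and
`(a + i x)_k (a - i x)_k` is written as `∏_{j < k} (x² + (a + j)²)`;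
see `wilson_eval_sq` for the usual form. -/
noncomputable def wilson (n : ℕ) (a b c d : ℂ) : ℂ[X] :=
  ∑ k ∈ Finset.range (n + 1),
    C (poch (-n) k * poch (n + a + b + c + d - 1) k / (k.factorial : ℂ)
        * (poch (a + b + k) (n - k) * poch (a + c + k) (n - k) * poch (a + d + k) (n - k)))
      * ∏ j ∈ Finset.range k, (X + C ((a + j) ^ 2))

/-- The rescaled Wilson polynomial `W̃_n(y | a, b, c, d) = W_n(-y / 4 | a, b, c, d)`. -/
noncomputable def wilsonTilde (n : ℕ) (a b c d : ℂ) : ℂ[X] :=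
  (wilson n a b c d).comp (C (-1 / 4) * X)

/-- The generalized hypergeometric series `₄F₃(a₁, a₂, a₃, a₄; b₁, b₂, b₃; z)`. -/
noncomputable def hyp4F3 (a₁ a₂ a₃ a₄ b₁ b₂ b₃ z : ℂ) : ℂ :=
  ∑' k : ℕ, poch a₁ k * poch a₂ k * poch a₃ k * poch a₄ k
    / (poch b₁ k * poch b₂ k * poch b₃ k * (k.factorial : ℂ)) * z ^ k

theorem poch_split (z : ℂ) {k n : ℕ} (h : k ≤ n) : poch z n = poch z k * poch (z + k) (n - k) := by
  obtain ⟨m, rfl⟩ := Nat.exists_eq_add_of_le h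
  have := congrArg (Polynomial.eval z) (ascPochhammer_mul ℂ k m)
  simp only [poch, Nat.add_sub_cancel_left, ← this]
  simp

theorem poch_mul_conj (a x : ℂ) (k : ℕ) :
    poch (a + Complex.I * x) k * poch (a - Complex.I * x) k
      = ∏ j ∈ Finset.range k, (x ^ 2 + (a + j) ^ 2) := by
  induction k with
  | zero => simp [poch]
  | succ k ih =>
    rw [Finset.prod_range_succ, ← ih]
    simp only [poch, ascPochhammer_succ_eval]
    linear_combination (-((ascPochhammer ℂ k).eval (a + Complex.I * x)
      * (ascPochhammer ℂ k).eval (a - Complex.I * x)) * x ^ 2) * Complex.I_sq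

/-- The usual hypergeometric form of the Wilson polynomials. -/
theorem wilson_eval_sq (n : ℕ) (a b c d x : ℂ)
    (hb : poch (a + b) n ≠ 0) (hc : poch (a + c) n ≠ 0) (hd : poch (a + d) n ≠ 0) :
    (wilson n a b c d).eval (x ^ 2) = poch (a + b) n * poch (a + c) n * poch (a + d) n
      * hyp4F3 (-n) (n + a + b + c + d - 1) (a + Complex.I * x) (a - Complex.I * x)
          (a + b) (a + c) (a + d) 1 := by
  have hz : ∀ k ∉ Finset.range (n + 1), poch (-n) k = 0 := by
    intro k hk
    exact ascPochhammer_eval_neg_coe_nat_of_lt (by simpa using hk)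
  rw [hyp4F3, tsum_eq_sum (s := Finset.range (n + 1)) (fun k hk => by simp [hz k hk]),
    Finset.mul_sum, wilson, eval_finsetSum]
  refine Finset.sum_congr rfl fun k hk => ?_
  have hk' : k ≤ n := by simpa [Nat.lt_succ_iff] using hk
  rw [poch_split _ hk'] at hb hc hd
  rw [poch_split (a + b) hk', poch_split (a + c) hk', poch_split (a + d) hk']
  have h1 := left_ne_zero_of_mul hb
  have h2 := left_ne_zero_of_mul hc
  have h3 := left_ne_zero_of_mul hd
  have h4 : (k.factorial : ℂ) ≠ 0 := by exact_mod_cast k.factorial_ne_zero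
  simp only [eval_mul, eval_C, eval_prod, eval_add, eval_X]
  rw [← poch_mul_conj]
  field_simp
  simp

/-- The names of the four generators `S₀`, `S₃`, `S₊`, `S₋`. -/
inductive Gen
  | zero
  | three
  | plus
  | minus

/-- The anticommutator `{x, y} = x y + y x`. -/
def acomm {A : Type*} [Ring A] (x y : A) : A := x * y + y * x

/-- A generator, in the free unital associative algebra. -/
def gen (g : Gen) : FreeAlgebra ℂ Gen := FreeAlgebra.ι ℂ g

/-- The defining relations; `⁅x, y⁆ = x y - y x`. -/
inductive Rel : FreeAlgebra ℂ Gen → FreeAlgebra ℂ Gen → Prop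
  | zero_minus : Rel ⁅gen .zero, gen .minus⁆ (-(2 : ℂ) • acomm (gen .minus) (gen .minus))
  | zero_plus : Rel ⁅gen .zero, gen .plus⁆
      ((16 : ℂ) • acomm (gen .three) (gen .minus) - (16 : ℂ) • acomm (gen .minus) (gen .minus)
        + (2 : ℂ) • acomm (gen .plus) (gen .minus) - (4 : ℂ) • acomm (gen .three) (gen .three))
  | plus_minus : Rel ⁅gen .plus, gen .minus⁆ ((2 : ℂ) • acomm (gen .zero) (gen .three))
  | zero_three : Rel ⁅gen .zero, gen .three⁆
      ((2 : ℂ) • acomm (gen .three) (gen .minus) - (8 : ℂ) • acomm (gen .minus) (gen .minus))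
  | three_plus : Rel ⁅gen .three, gen .plus⁆ (acomm (gen .zero) (gen .plus))
  | three_minus : Rel ⁅gen .three, gen .minus⁆ (-acomm (gen .zero) (gen .minus))

/-- The rational degenerate Sklyanin algebra, as a unital associative algebra over `ℂ`. -/
abbrev SkAlg : Type := RingQuot Rel

/-- The generators `S₀`, `S₃`, `S₊`, `S₋` of the rational degenerate Sklyanin algebra. -/
noncomputable def S (g : Gen) : SkAlg := RingQuot.mkAlgHom ℂ Rel (gen g)

section Coefficients

variable (a b c d : ℂ)

/-- The elementary symmetric polynomials `e₁, …, e₄` in the four parameters. -/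
def e1 : ℂ := a + b + c + d
def e2 : ℂ := a * b + a * c + a * d + b * c + b * d + c * d
def e3 : ℂ := a * b * c + a * b * d + a * c * d + b * c * d
def e4 : ℂ := a * b * c * d

noncomputable def sigma : ℂ := (a + b - c - d)⁻¹

noncomputable def alpha : ℂ := e1 a b c d ^ 2 / 2 - 4 / 3 * e2 a b c d

def beta : ℂ := -e1 a b c d ^ 3 + 4 * e2 a b c d * e1 a b c d - 8 * e3 a b c d

noncomputable def xi : ℂ := 1 / 16 * (1 - 2 * e1 a b c d ^ 2 + e1 a b c d ^ 4 - 256 * e4 a b c d)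

end Coefficients

end RationalSklyanin

open RationalSklyanin

/-!
Under the prescribed formulas each generator acts on polynomials in `x²` as a difference operator
`f(x²) ↦ (φ(x) f((x + 1)²) - φ(-x) f((x - 1)²)) / x`. With `u = x + e₁ / 2 - 1`, the symbols `φ` of
`S₀, S₃, S₋, S₊` are `-2u`, `-(4u² + 1) / 2`, `-1 / 2` and `(4u² - 1)² / 2`, and for these the six
relations are polynomial identities, whatever the shift in `u`. The symbols `1`, `φ_a φ_b`,
`φ_c φ_d` and `φ_a φ_b φ_c φ_d`, where `φ_a(x) = a - 1/2 + x/2`, send `W̃_n` to multiples of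
`D_{n-1}`, `A_n`, `B_n` and `E_{n+1}`; expanding the symbols of the generators in these four
products gives the formulas. There is one `W̃_n` in each degree, so they form a basis, and hence
the formulas determine the representation.
-/

namespace RationalSklyanin

open Polynomial

section OddPart

variable {R : Type*} [CommRing R]

/-- The polynomial `q` in the decomposition `p(x) = r(x²) + x q(x²)`. -/
noncomputable def oddPart : R[X] →ₗ[R] R[X] where
  toFun p := contract 2 p.divX
  map_add' p q := by rw [divX_add, contract_add two_ne_zero]
  map_smul' r p := by ext n; simp [coeff_contract, coeff_divX]

theorem expand_contract_add_X_mul_expand_oddPart (p : R[X]) :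
    expand R 2 (contract 2 p) + X * expand R 2 (oddPart p) = p := by
  ext n
  obtain ⟨k, rfl | rfl⟩ := n.even_or_odd'
  · rcases k with - | k
    · simp [coeff_expand, coeff_contract]
    · rw [coeff_add, show 2 * (k + 1) = 2 * k + 1 + 1 by ring, coeff_X_mul]
      have hk : ¬ 2 ∣ 2 * k + 1 := by omega
      rw [coeff_expand two_pos (oddPart p), if_neg hk, add_zero,
        show 2 * k + 1 + 1 = 2 * (k + 1) by ring, coeff_expand_mul' two_pos,
        coeff_contract two_ne_zero, mul_comm]
  · have hk : ¬ 2 ∣ 2 * k + 1 := by omega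
    rw [coeff_add, coeff_X_mul, coeff_expand two_pos, if_neg hk, zero_add,
      coeff_expand_mul' two_pos]
    simp [oddPart, coeff_contract, coeff_divX, mul_comm]

theorem two_mul_self_mul_eval_oddPart (p : R[X]) (x : R) :
    2 * (x * (oddPart p).eval (x ^ 2)) = p.eval x - p.eval (-x) := by
  have heval (y : R) : (contract 2 p).eval (y ^ 2) + y * (oddPart p).eval (y ^ 2) = p.eval y := by
    simpa only [eval_add, eval_mul, eval_X, expand_eval] using
      congrArg (eval y) (expand_contract_add_X_mul_expand_oddPart p)
  have hneg := heval (-x)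
  rw [neg_sq] at hneg
  linear_combination heval x - hneg

end OddPart

section DifferenceOperator

variable {R : Type*} [CommRing R]

/-- The difference operator `f(x²) ↦ (φ(x) f((x + 1)²) - φ(-x) f((x - 1)²)) / x` with symbol `φ`,
acting on polynomials in `x²`. The numerator is twice the odd part of `φ(x) f((x + 1)²)`, so that
no division is needed. -/
noncomputable def diffOp : R[X] →ₗ[R] Module.End R R[X] :=
  ((LinearMap.mul R R[X]).compl₂ (aeval ((X + 1) ^ 2 : R[X])).toLinearMap).compr₂
    ((2 : R) • oddPart)

theorem mul_eval_diffOp (φ f : R[X]) (x : R) :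
    x * (diffOp φ f).eval (x ^ 2)
      = φ.eval x * f.eval ((x + 1) ^ 2) - φ.eval (-x) * f.eval ((x - 1) ^ 2) := by
  have h := two_mul_self_mul_eval_oddPart (φ * f.comp ((X + 1) ^ 2)) x
  simp only [eval_mul, eval_comp, eval_pow, eval_add, eval_X, eval_one] at h
  rw [show (-x + 1) ^ 2 = (x - 1) ^ 2 by ring] at h
  simp only [diffOp, LinearMap.compr₂_apply, LinearMap.compl₂_apply, LinearMap.mul_apply',
    AlgHom.toLinearMap_apply, ← comp_eq_aeval, LinearMap.smul_apply, eval_smul, smul_eq_mul]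
  rw [← h]
  ring

theorem eval_diffOp_diffOp (φ ψ f : R[X]) {x w : R} (hw : w * (x * (x + 1) * (x - 1)) = 1) :
    (diffOp φ (diffOp ψ f)).eval (x ^ 2)
      = w * ((x - 1) * φ.eval x
          * (ψ.eval (x + 1) * f.eval ((x + 2) ^ 2) - ψ.eval (-(x + 1)) * f.eval (x ^ 2))
        - (x + 1) * φ.eval (-x)
          * (ψ.eval (x - 1) * f.eval (x ^ 2) - ψ.eval (-(x - 1)) * f.eval ((x - 2) ^ 2))) := by
  have hadd := mul_eval_diffOp ψ f (x + 1)
  have hsub := mul_eval_diffOp ψ f (x - 1)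
  rw [add_sub_cancel_right, show x + 1 + 1 = x + 2 by ring] at hadd
  rw [sub_add_cancel, show x - 1 - 1 = x - 2 by ring] at hsub
  linear_combination -(diffOp φ (diffOp ψ f)).eval (x ^ 2) * hw
    + w * ((x + 1) * (x - 1) * mul_eval_diffOp φ (diffOp ψ f) x
      + (x - 1) * φ.eval x * hadd - (x + 1) * φ.eval (-x) * hsub)

theorem eq_of_eval_sq_eq [IsDomain R] [Infinite R] {p q r : R[X]} (hr : r ≠ 0)
    (h : ∀ x, r.eval x ≠ 0 → p.eval (x ^ 2) = q.eval (x ^ 2)) : p = q := by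
  refine expand_injective two_pos (mul_left_cancel₀ hr (Polynomial.funext fun x => ?_))
  simp only [eval_mul, expand_eval]
  rcases eq_or_ne (r.eval x) 0 with hx | hx
  · rw [hx, zero_mul, zero_mul]
  · rw [h x hx]

theorem diffOp_eq_of_eval [IsDomain R] [Infinite R] {φ f g : R[X]}
    (h : ∀ x, φ.eval x * f.eval ((x + 1) ^ 2) - φ.eval (-x) * f.eval ((x - 1) ^ 2)
      = x * g.eval (x ^ 2)) : diffOp φ f = g :=
  eq_of_eval_sq_eq X_ne_zero fun x hx =>
    mul_left_cancel₀ (by rwa [eval_X] at hx) ((mul_eval_diffOp φ f x).trans (h x))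

end DifferenceOperator

section Representation

/-- The symbols, in the sense of `diffOp`, by which the generators act in `sklyaninRep s`. They are
polynomials in `x + s`, and the rescaled Wilson polynomials lead to `s = e₁ / 2 - 1`, see
`wilsonSymbol_eq_genSymbol`. -/
noncomputable def genSymbol (s : ℂ) : Gen → ℂ[X]
  | .zero => C (-2) * (X + C s)
  | .three => C (-1 / 2) * (4 * (X + C s) ^ 2 + 1)
  | .plus => C (1 / 2) * (4 * (X + C s) ^ 2 - 1) ^ 2
  | .minus => C (-1 / 2)

/-- Both sides are second-order difference operators in `f`; after clearing the denominator
`x (x + 1) (x - 1)` each relation is a polynomial identity between the coefficients of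
`f((x + 2)²)`, `f(x²)` and `f((x - 2)²)`. -/
theorem lift_diffOp_genSymbol_eq_of_rel (s : ℂ) ⦃u v : FreeAlgebra ℂ Gen⦄ (h : Rel u v) :
    FreeAlgebra.lift ℂ (fun g => diffOp (genSymbol s g)) u
      = FreeAlgebra.lift ℂ (fun g => diffOp (genSymbol s g)) v := by
  have hr : (X * (X + 1) * (X - 1) : ℂ[X]) ≠ 0 :=
    mul_ne_zero (mul_ne_zero X_ne_zero (X_add_C_ne_zero 1)) (X_sub_C_ne_zero 1)
  refine LinearMap.ext fun f => eq_of_eval_sq_eq hr fun x hx => ?_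
  simp only [eval_mul, eval_add, eval_sub, eval_X, eval_one] at hx
  have hcomp (φ ψ : ℂ[X]) := eval_diffOp_diffOp φ ψ f (inv_mul_cancel₀ hx)
  generalize (x * (x + 1) * (x - 1))⁻¹ = w at hcomp
  rcases h with _ | _ | _ | _ | _ | _ <;>
    simp only [gen, acomm, Ring.lie_def, map_add, map_sub, map_mul, map_neg, map_smul,
      FreeAlgebra.lift_ι_apply, LinearMap.add_apply, LinearMap.sub_apply, LinearMap.neg_apply,
      LinearMap.smul_apply, Module.End.mul_apply, eval_add, eval_sub, eval_mul, eval_neg,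
      eval_smul, eval_pow, eval_C, eval_X, eval_one, eval_ofNat, smul_eq_mul, hcomp, genSymbol] <;>
    ring

/-- The representation of the rational degenerate Sklyanin algebra on polynomials in `x²` in which
every generator acts as a first-order difference operator. -/
noncomputable def sklyaninRep (s : ℂ) : SkAlg →ₐ[ℂ] Module.End ℂ ℂ[X] :=
  RingQuot.liftAlgHom ℂ
    ⟨FreeAlgebra.lift ℂ fun g => diffOp (genSymbol s g), lift_diffOp_genSymbol_eq_of_rel s⟩

theorem sklyaninRep_S (s : ℂ) (g : Gen) : sklyaninRep s (S g) = diffOp (genSymbol s g) := by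
  rw [sklyaninRep, S, RingQuot.liftAlgHom_mkAlgHom_apply, gen, FreeAlgebra.lift_ι_apply]

theorem algHom_ext_of_S {A : Type*} [Semiring A] [Algebra ℂ A] {ρ τ : SkAlg →ₐ[ℂ] A}
    (h : ∀ g, ρ (S g) = τ (S g)) : ρ = τ :=
  RingQuot.ringQuot_ext' _ _ _ (FreeAlgebra.hom_ext (funext h))

end Representation

section Pochhammer

theorem poch_zero (z : ℂ) : poch z 0 = 1 := by simp [poch]

theorem poch_succ_right (z : ℂ) (k : ℕ) : poch z (k + 1) = poch z k * (z + k) :=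
  ascPochhammer_succ_eval k z

theorem poch_succ_left (z : ℂ) (k : ℕ) : poch z (k + 1) = z * poch (z + 1) k := by
  simp [poch, ascPochhammer_succ_left]

theorem mul_poch_add_one (z : ℂ) (k : ℕ) : z * poch (z + 1) k = poch z k * (z + k) := by
  rw [← poch_succ_left, poch_succ_right]

theorem poch_eq_zero_iff {z : ℂ} {k : ℕ} : poch z k = 0 ↔ ∃ j < k, (j : ℂ) = -z :=
  ascPochhammer_eval_eq_zero_iff k z

theorem poch_neg_natCast_eq_zero_iff {n k : ℕ} : poch (-n) k = 0 ↔ n < k := by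
  simp [poch_eq_zero_iff]

end Pochhammer

section PochPair

/-- The polynomial in `x²` whose value is `(a - x/2)_k (a + x/2)_k`, used to expand the rescaled
Wilson polynomials. -/
noncomputable def pochPair (a : ℂ) (k : ℕ) : ℂ[X] :=
  ∏ j ∈ Finset.range k, (C (-1 / 4) * X + C ((a + j) ^ 2))

theorem eval_sq_pochPair (a : ℂ) (k : ℕ) (x : ℂ) :
    (pochPair a k).eval (x ^ 2) = poch (a - x / 2) k * poch (a + x / 2) k := by
  induction k with
  | zero => simp [pochPair, poch_zero]
  | succ k ih =>
    rw [pochPair, Finset.prod_range_succ, eval_mul, ← pochPair, ih, poch_succ_right,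
      poch_succ_right]
    simp only [eval_add, eval_mul, eval_C, eval_X]
    ring

theorem pochPair_succ (a : ℂ) (k : ℕ) :
    pochPair a (k + 1) = pochPair a k * (C (-1 / 4) * X + C ((a + k) ^ 2)) :=
  Finset.prod_range_succ _ k

theorem degree_pochPair (a : ℂ) (k : ℕ) : (pochPair a k).degree = k := by
  rw [pochPair, degree_prod, Finset.sum_congr rfl fun j _ => degree_linear (by norm_num)]
  simp

/-- The symbol `a - 1/2 + x/2`. It precedes the factors of the Pochhammer symbol
`(a + (x + 1)/2)_k` in `pochPair a k ((x + 1)²)`, so multiplying by it lowers the parameter `a`. -/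
noncomputable def linSymbol (a : ℂ) : ℂ[X] := C (1 / 2) * X + C (a - 1 / 2)

theorem eval_linSymbol (a x : ℂ) : (linSymbol a).eval x = a - 1 / 2 + x / 2 := by
  simp only [linSymbol, eval_add, eval_mul, eval_C, eval_X]
  ring

theorem linSymbol_mul_eval_pochPair_add_one (a : ℂ) (k : ℕ) (x : ℂ) :
    (linSymbol a).eval x * (pochPair a k).eval ((x + 1) ^ 2)
      = (a - 1 / 2 + x / 2 + k) * (pochPair (a - 1 / 2) k).eval (x ^ 2) := by
  have h := mul_poch_add_one (a - 1 / 2 + x / 2) k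
  rw [eval_linSymbol, eval_sq_pochPair, eval_sq_pochPair,
    show a - (x + 1) / 2 = a - 1 / 2 - x / 2 by ring,
    show a + (x + 1) / 2 = a - 1 / 2 + x / 2 + 1 by ring]
  linear_combination poch (a - 1 / 2 - x / 2) k * h

theorem linSymbol_mul_eval_pochPair_sub_one (a : ℂ) (k : ℕ) (x : ℂ) :
    (linSymbol a).eval (-x) * (pochPair a k).eval ((x - 1) ^ 2)
      = (a - 1 / 2 - x / 2 + k) * (pochPair (a - 1 / 2) k).eval (x ^ 2) := by
  have h := linSymbol_mul_eval_pochPair_add_one a k (-x)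
  rw [show (-x + 1) ^ 2 = (x - 1) ^ 2 by ring, neg_sq] at h
  linear_combination h

theorem eval_pochPair_succ_add_one (a : ℂ) (k : ℕ) (x : ℂ) :
    (pochPair a (k + 1)).eval ((x + 1) ^ 2)
      = (a - 1 / 2 - x / 2) * (a + 1 / 2 + x / 2 + k) * (pochPair (a + 1 / 2) k).eval (x ^ 2) := by
  rw [eval_sq_pochPair, eval_sq_pochPair, poch_succ_left, poch_succ_right,
    show a - (x + 1) / 2 + 1 = a + 1 / 2 - x / 2 by ring,
    show a + (x + 1) / 2 = a + 1 / 2 + x / 2 by ring]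
  ring

theorem eval_pochPair_succ_sub_one (a : ℂ) (k : ℕ) (x : ℂ) :
    (pochPair a (k + 1)).eval ((x - 1) ^ 2)
      = (a - 1 / 2 + x / 2) * (a + 1 / 2 - x / 2 + k) * (pochPair (a + 1 / 2) k).eval (x ^ 2) := by
  have h := eval_pochPair_succ_add_one a k (-x)
  rw [show (-x + 1) ^ 2 = (x - 1) ^ 2 by ring, neg_sq] at h
  linear_combination h

theorem diffOp_one_pochPair (a : ℂ) (k : ℕ) :
    diffOp 1 (pochPair a k) = -(k : ℂ) • pochPair (a + 1 / 2) (k - 1) := by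
  refine diffOp_eq_of_eval fun x => ?_
  cases k with
  | zero => simp [pochPair]
  | succ k =>
    rw [eval_pochPair_succ_add_one, eval_pochPair_succ_sub_one, Nat.add_sub_cancel, eval_smul,
      eval_one, eval_one, smul_eq_mul]
    push_cast
    ring

theorem diffOp_linSymbol_mul_pochPair_lower (a b : ℂ) (k : ℕ) :
    diffOp (linSymbol a * linSymbol b) (pochPair a k)
      = (a + b - 1 + k) • pochPair (a - 1 / 2) k := by
  refine diffOp_eq_of_eval fun x => ?_
  simp only [eval_mul, eval_smul, smul_eq_mul]
  have hadd := linSymbol_mul_eval_pochPair_add_one a k x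
  have hsub := linSymbol_mul_eval_pochPair_sub_one a k x
  simp only [eval_linSymbol] at hadd hsub ⊢
  linear_combination (b - 1 / 2 + x / 2) * hadd - (b - 1 / 2 - x / 2) * hsub

theorem diffOp_linSymbol_mul_pochPair_raise (a c d : ℂ) (k : ℕ) :
    diffOp (linSymbol c * linSymbol d) (pochPair a k)
      = (c + d - 1 + k) • pochPair (a + 1 / 2) k
        - (k * (a + c - 1 + k) * (a + d - 1 + k)) • pochPair (a + 1 / 2) (k - 1) := by
  refine diffOp_eq_of_eval fun x => ?_
  simp only [eval_mul, eval_sub, eval_smul, smul_eq_mul, eval_linSymbol]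
  cases k with
  | zero =>
    simp only [pochPair, Finset.prod_range_zero, eval_one, Nat.cast_zero]
    ring
  | succ k =>
    rw [eval_pochPair_succ_add_one, eval_pochPair_succ_sub_one, Nat.add_sub_cancel, pochPair_succ]
    simp only [eval_mul, eval_add, eval_C, eval_X, Nat.cast_succ]
    ring

theorem diffOp_prod_linSymbol_pochPair (a b c d : ℂ) (k : ℕ) :
    diffOp (linSymbol a * linSymbol b * linSymbol c * linSymbol d) (pochPair a k)
      = ((a + b - 1 + k) * (a + c - 1 + k) * (a + d - 1 + k)) • pochPair (a - 1 / 2) k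
        - (e1 a b c d - 2 + k) • pochPair (a - 1 / 2) (k + 1) := by
  refine diffOp_eq_of_eval fun x => ?_
  have hadd := linSymbol_mul_eval_pochPair_add_one a k x
  have hsub := linSymbol_mul_eval_pochPair_sub_one a k x
  rw [pochPair_succ, e1]
  simp only [eval_mul, eval_sub, eval_add, eval_smul, smul_eq_mul, eval_C, eval_X,
    eval_linSymbol] at hadd hsub ⊢
  linear_combination (b - 1 / 2 + x / 2) * (c - 1 / 2 + x / 2) * (d - 1 / 2 + x / 2) * hadd
    - (b - 1 / 2 - x / 2) * (c - 1 / 2 - x / 2) * (d - 1 / 2 - x / 2) * hsub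

end PochPair

section WilsonCoefficients

variable (n : ℕ) (a b c d : ℂ) (k : ℕ)

/-- The coefficient of `pochPair a k` in the rescaled Wilson polynomial `wilsonTilde n a b c d`. -/
noncomputable def wilsonCoeff : ℂ :=
  poch (-n) k * poch (n + a + b + c + d - 1) k / (k.factorial : ℂ)
    * (poch (a + b + k) (n - k) * poch (a + c + k) (n - k) * poch (a + d + k) (n - k))

variable {n k} in
theorem wilsonCoeff_eq_zero_of_lt (h : n < k) : wilsonCoeff n a b c d k = 0 := by
  simp [wilsonCoeff, poch_neg_natCast_eq_zero_iff.mpr h]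

theorem wilsonCoeff_self : wilsonCoeff n a b c d n
    = poch (-n) n * poch (n + a + b + c + d - 1) n / (n.factorial : ℂ) := by
  simp [wilsonCoeff, poch_zero]

variable {n} in
theorem wilsonTilde_eq_sum {N : ℕ} (hN : n < N) :
    wilsonTilde n a b c d = ∑ k ∈ Finset.range N, wilsonCoeff n a b c d k • pochPair a k := by
  have hrange : Finset.range (n + 1) ⊆ Finset.range N := Finset.range_subset_range.mpr hN
  rw [← Finset.sum_subset hrange fun k _ hk => by
    rw [wilsonCoeff_eq_zero_of_lt a b c d (by simpa using hk), zero_smul]]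
  simp [wilsonTilde, wilson, wilsonCoeff, pochPair, Polynomial.sum_comp, prod_comp, smul_eq_C_mul]

theorem wilsonCoeff_ratio :
    (k + 1) * ((a + b + k) * (a + c + k) * (a + d + k)) * wilsonCoeff n a b c d (k + 1)
      = (k - n) * (n + k + e1 a b c d - 1) * wilsonCoeff n a b c d k := by
  rcases lt_trichotomy n k with hlt | rfl | hlt
  · rw [wilsonCoeff_eq_zero_of_lt a b c d hlt,
      wilsonCoeff_eq_zero_of_lt a b c d (Nat.lt_succ_of_lt hlt)]
    ring
  · rw [wilsonCoeff_eq_zero_of_lt a b c d n.lt_succ_self]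
    ring
  · obtain ⟨m, rfl⟩ : ∃ m, n = k + m + 1 := ⟨n - k - 1, by omega⟩
    have hk : (k + 1 : ℂ) ≠ 0 := k.cast_add_one_ne_zero
    have hfact : (k.factorial : ℂ) ≠ 0 := by exact_mod_cast k.factorial_ne_zero
    simp only [wilsonCoeff, e1]
    rw [show k + m + 1 - k = m + 1 by omega, show k + m + 1 - (k + 1) = m by omega,
      poch_succ_left (a + b + k), poch_succ_left (a + c + k), poch_succ_left (a + d + k),
      poch_succ_right _ k, poch_succ_right _ k, Nat.factorial_succ]
    push_cast
    simp only [← add_assoc]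
    field_simp
    ring

theorem wilsonCoeff_succ_mul_neg :
    wilsonCoeff n a b c d (k + 1) * -(k + 1)
      = n * (n + e1 a b c d - 1)
        * wilsonCoeff (n - 1) (a + 1 / 2) (b + 1 / 2) (c + 1 / 2) (d + 1 / 2) k := by
  cases n with
  | zero => simp [wilsonCoeff_eq_zero_of_lt]
  | succ n =>
    have hk : (k + 1 : ℂ) ≠ 0 := k.cast_add_one_ne_zero
    have hfact : (k.factorial : ℂ) ≠ 0 := by exact_mod_cast k.factorial_ne_zero
    simp only [wilsonCoeff, e1, poch_succ_left _ k, Nat.factorial_succ, Nat.add_sub_cancel,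
      Nat.add_sub_add_right]
    push_cast
    rw [show -((n : ℂ) + 1) + 1 = -n by ring,
      show (n : ℂ) + 1 + a + b + c + d - 1 + 1
        = n + (a + 1 / 2) + (b + 1 / 2) + (c + 1 / 2) + (d + 1 / 2) - 1 by ring,
      show a + b + ((k : ℂ) + 1) = a + 1 / 2 + (b + 1 / 2) + k by ring,
      show a + c + ((k : ℂ) + 1) = a + 1 / 2 + (c + 1 / 2) + k by ring,
      show a + d + ((k : ℂ) + 1) = a + 1 / 2 + (d + 1 / 2) + k by ring]
    field_simp
    ring

theorem wilsonCoeff_mul_add :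
    wilsonCoeff n a b c d k * (a + b - 1 + k)
      = (n + a + b - 1) * wilsonCoeff n (a - 1 / 2) (b - 1 / 2) (c + 1 / 2) (d + 1 / 2) k := by
  rcases lt_or_ge n k with hlt | hle
  · simp only [wilsonCoeff_eq_zero_of_lt _ _ _ _ hlt, zero_mul, mul_zero]
  have h := mul_poch_add_one (a + b - 1 + k) (n - k)
  rw [Nat.cast_sub hle, show a + b - 1 + (k : ℂ) + 1 = a + b + k by ring] at h
  simp only [wilsonCoeff]
  rw [show (n : ℂ) + (a - 1 / 2) + (b - 1 / 2) + (c + 1 / 2) + (d + 1 / 2) - 1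
      = n + a + b + c + d - 1 by ring,
    show a - 1 / 2 + (b - 1 / 2) + (k : ℂ) = a + b - 1 + k by ring,
    show a - 1 / 2 + (c + 1 / 2) + (k : ℂ) = a + c + k by ring,
    show a - 1 / 2 + (d + 1 / 2) + (k : ℂ) = a + d + k by ring]
  linear_combination poch (-n) k * poch (n + a + b + c + d - 1) k / (k.factorial : ℂ)
    * (poch (a + c + k) (n - k) * poch (a + d + k) (n - k)) * h

theorem wilsonCoeff_mul_sub_succ :
    wilsonCoeff n a b c d k * (c + d - 1 + k)
        - wilsonCoeff n a b c d (k + 1) * ((k + 1) * (a + c + k) * (a + d + k))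
      = (n + c + d - 1) * wilsonCoeff n (a + 1 / 2) (b + 1 / 2) (c - 1 / 2) (d - 1 / 2) k := by
  have hsum : (n : ℂ) + (a + 1 / 2) + (b + 1 / 2) + (c - 1 / 2) + (d - 1 / 2) - 1
      = n + a + b + c + d - 1 := by ring
  have hab : a + 1 / 2 + (b + 1 / 2) + (k : ℂ) = a + b + k + 1 := by ring
  have hac : a + 1 / 2 + (c - 1 / 2) + (k : ℂ) = a + c + k := by ring
  have had : a + 1 / 2 + (d - 1 / 2) + (k : ℂ) = a + d + k := by ring
  rcases lt_trichotomy n k with hlt | rfl | hlt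
  · simp only [wilsonCoeff_eq_zero_of_lt _ _ _ _ hlt,
      wilsonCoeff_eq_zero_of_lt _ _ _ _ (Nat.lt_succ_of_lt hlt)]
    ring
  · rw [wilsonCoeff_eq_zero_of_lt a b c d n.lt_succ_self, wilsonCoeff_self, wilsonCoeff_self, hsum]
    ring
  · obtain ⟨m, rfl⟩ : ∃ m, n = k + m + 1 := ⟨n - k - 1, by omega⟩
    have hk : (k + 1 : ℂ) ≠ 0 := k.cast_add_one_ne_zero
    have hfact : (k.factorial : ℂ) ≠ 0 := by exact_mod_cast k.factorial_ne_zero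
    simp only [wilsonCoeff, hsum, hab, hac, had]
    rw [show k + m + 1 - k = m + 1 by omega, show k + m + 1 - (k + 1) = m by omega,
      poch_succ_right (a + b + k + 1), poch_succ_left (a + b + k), poch_succ_left (a + c + k),
      poch_succ_left (a + d + k), poch_succ_right _ k, poch_succ_right _ k, Nat.factorial_succ]
    push_cast
    simp only [← add_assoc]
    field_simp
    ring

theorem wilsonCoeff_zero_mul :
    wilsonCoeff n a b c d 0 * ((a + b - 1) * (a + c - 1) * (a + d - 1))
      = wilsonCoeff (n + 1) (a - 1 / 2) (b - 1 / 2) (c - 1 / 2) (d - 1 / 2) 0 := by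
  have hshift (z w : ℂ) : poch (z - 1 / 2 + (w - 1 / 2)) (n + 1)
      = (z + w - 1) * poch (z + w) n := by
    rw [show z - 1 / 2 + (w - 1 / 2) = z + w - 1 by ring, poch_succ_left, sub_add_cancel]
  simp only [wilsonCoeff, poch_zero, Nat.cast_zero, add_zero, Nat.sub_zero, hshift]
  ring

theorem wilsonCoeff_succ_mul_sub :
    wilsonCoeff n a b c d (k + 1) * ((a + b + k) * (a + c + k) * (a + d + k))
        - wilsonCoeff n a b c d k * (e1 a b c d - 2 + k)
      = wilsonCoeff (n + 1) (a - 1 / 2) (b - 1 / 2) (c - 1 / 2) (d - 1 / 2) (k + 1) := by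
  have hlower := wilsonCoeff_succ_mul_neg (n + 1) (a - 1 / 2) (b - 1 / 2) (c - 1 / 2) (d - 1 / 2) k
  simp only [sub_add_cancel, Nat.add_sub_cancel, Nat.cast_succ] at hlower
  have hratio := wilsonCoeff_ratio n a b c d k
  refine mul_left_cancel₀ (k.cast_add_one_ne_zero : (k + 1 : ℂ) ≠ 0) ?_
  simp only [e1] at hlower hratio ⊢
  linear_combination hratio + hlower

end WilsonCoefficients

section Contiguity

variable (n : ℕ) (a b c d : ℂ)

theorem diffOp_one_wilsonTilde :
    diffOp 1 (wilsonTilde n a b c d) = (n * (n + e1 a b c d - 1)) •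
      wilsonTilde (n - 1) (a + 1 / 2) (b + 1 / 2) (c + 1 / 2) (d + 1 / 2) := by
  rw [wilsonTilde_eq_sum a b c d (show n < n + 1 + 1 by omega), map_sum,
    wilsonTilde_eq_sum _ _ _ _ (show n - 1 < n + 1 by omega), Finset.sum_range_succ',
    Finset.smul_sum]
  simp only [map_smul, diffOp_one_pochPair, smul_smul, Nat.cast_succ, Nat.cast_zero, neg_zero,
    zero_smul, smul_zero, add_zero, Nat.add_sub_cancel, wilsonCoeff_succ_mul_neg]

theorem diffOp_linSymbol_mul_wilsonTilde_left :
    diffOp (linSymbol a * linSymbol b) (wilsonTilde n a b c d) = (n + a + b - 1) •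
      wilsonTilde n (a - 1 / 2) (b - 1 / 2) (c + 1 / 2) (d + 1 / 2) := by
  rw [wilsonTilde_eq_sum a b c d n.lt_succ_self, map_sum,
    wilsonTilde_eq_sum _ _ _ _ n.lt_succ_self, Finset.smul_sum]
  simp only [map_smul, diffOp_linSymbol_mul_pochPair_lower, smul_smul, wilsonCoeff_mul_add]

theorem diffOp_linSymbol_mul_wilsonTilde_right :
    diffOp (linSymbol c * linSymbol d) (wilsonTilde n a b c d) = (n + c + d - 1) •
      wilsonTilde n (a + 1 / 2) (b + 1 / 2) (c - 1 / 2) (d - 1 / 2) := by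
  rw [wilsonTilde_eq_sum a b c d (show n < n + 1 + 1 by omega), map_sum,
    wilsonTilde_eq_sum _ _ _ _ n.lt_succ_self, Finset.smul_sum]
  simp only [map_smul, diffOp_linSymbol_mul_pochPair_raise, smul_sub, smul_smul,
    Finset.sum_sub_distrib]
  rw [Finset.sum_range_succ, Finset.sum_range_succ' _ (n + 1),
    wilsonCoeff_eq_zero_of_lt a b c d n.lt_succ_self, zero_mul, zero_smul, Nat.cast_zero, zero_mul,
    zero_mul, mul_zero, zero_smul, add_zero, add_zero, ← Finset.sum_sub_distrib]
  refine Finset.sum_congr rfl fun k _ => ?_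
  rw [← wilsonCoeff_mul_sub_succ, Nat.add_sub_cancel]
  push_cast
  module

theorem diffOp_prod_linSymbol_wilsonTilde :
    diffOp (linSymbol a * linSymbol b * linSymbol c * linSymbol d) (wilsonTilde n a b c d)
      = wilsonTilde (n + 1) (a - 1 / 2) (b - 1 / 2) (c - 1 / 2) (d - 1 / 2) := by
  rw [wilsonTilde_eq_sum a b c d (show n < n + 1 + 1 by omega), map_sum,
    wilsonTilde_eq_sum _ _ _ _ (n + 1).lt_succ_self]
  simp only [map_smul, diffOp_prod_linSymbol_pochPair, smul_sub, smul_smul,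
    Finset.sum_sub_distrib]
  rw [Finset.sum_range_succ', Finset.sum_range_succ _ (n + 1), Finset.sum_range_succ' _ (n + 1),
    wilsonCoeff_eq_zero_of_lt a b c d n.lt_succ_self, zero_mul, zero_smul, add_zero]
  simp only [Nat.cast_zero, add_zero, wilsonCoeff_zero_mul]
  rw [add_sub_right_comm, ← Finset.sum_sub_distrib]
  congr 1
  refine Finset.sum_congr rfl fun k _ => ?_
  rw [← wilsonCoeff_succ_mul_sub]
  push_cast
  module

end Contiguity

section Basis

variable {a b c d : ℂ}

theorem degree_wilsonTilde {n : ℕ} (h : poch (n + a + b + c + d - 1) n ≠ 0) :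
    (wilsonTilde n a b c d).degree = n := by
  have hcoeff : wilsonCoeff n a b c d n ≠ 0 := by
    rw [wilsonCoeff_self]
    exact div_ne_zero (mul_ne_zero (poch_neg_natCast_eq_zero_iff.not.mpr (lt_irrefl n)) h)
      (by exact_mod_cast n.factorial_ne_zero)
  have hlead : (wilsonCoeff n a b c d n • pochPair a n).degree = n := by
    rw [smul_eq_C_mul, degree_C_mul hcoeff, degree_pochPair]
  rw [wilsonTilde_eq_sum a b c d n.lt_succ_self, Finset.sum_range_succ,
    degree_add_eq_right_of_degree_lt, hlead]
  rw [hlead]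
  refine (degree_sum_le _ _).trans_lt ((Finset.sup_lt_iff (WithBot.bot_lt_coe n)).mpr ?_)
  intro k hk
  calc (wilsonCoeff n a b c d k • pochPair a k).degree ≤ k :=
        (degree_smul_le _ _).trans (degree_pochPair a k).le
    _ < n := by exact_mod_cast Finset.mem_range.mp hk

/-- The rescaled Wilson polynomials, one in each degree when `a + b + c + d ∉ {0, -1, -2, …}`. -/
noncomputable def wilsonSequence (he : ∀ m : ℕ, a + b + c + d ≠ -m) : Polynomial.Sequence ℂ where
  elems' n := wilsonTilde n a b c d
  degree_eq' n := degree_wilsonTilde fun h => by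
    obtain ⟨j, hj, hsum⟩ := poch_eq_zero_iff.mp h
    obtain ⟨m, rfl⟩ := Nat.exists_eq_add_of_lt hj
    refine he (2 * j + m) ?_
    push_cast at hsum ⊢
    linear_combination hsum

theorem linearIndependent_wilsonTilde (he : ∀ m : ℕ, a + b + c + d ≠ -m) :
    LinearIndependent ℂ fun n : ℕ => wilsonTilde n a b c d :=
  (wilsonSequence he).linearIndependent

theorem span_range_wilsonTilde (he : ∀ m : ℕ, a + b + c + d ≠ -m) :
    Submodule.span ℂ (Set.range fun n : ℕ => wilsonTilde n a b c d) = ⊤ :=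
  (wilsonSequence he).span fun n =>
    (leadingCoeff_ne_zero.mpr ((wilsonSequence he).ne_zero n)).isUnit

end Basis

section Action

/-- The prescribed image of `wilsonTilde n a b c d` under a generator. -/
noncomputable def wilsonAction (n : ℕ) (a b c d : ℂ) : Gen → ℂ[X]
  | .zero =>
      (4 * sigma a b c d * (n + c + d - 1)) •
        wilsonTilde n (a + 1 / 2) (b + 1 / 2) (c - 1 / 2) (d - 1 / 2)
      + ((4 * sigma a b c d * (a * b - c * d) - e1 a b c d) * n * (n + e1 a b c d - 1)) •
        wilsonTilde (n - 1) (a + 1 / 2) (b + 1 / 2) (c + 1 / 2) (d + 1 / 2)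
      - (4 * sigma a b c d * (n + a + b - 1)) •
        wilsonTilde n (a - 1 / 2) (b - 1 / 2) (c + 1 / 2) (d + 1 / 2)
  | .three =>
      - (4 * (n + a + b - 1) : ℂ) •
        wilsonTilde n (a - 1 / 2) (b - 1 / 2) (c + 1 / 2) (d + 1 / 2)
      + (1 / 2 * (8 * (a * b + c * d) - e1 a b c d ^ 2 - 1) * n * (n + e1 a b c d - 1)) •
        wilsonTilde (n - 1) (a + 1 / 2) (b + 1 / 2) (c + 1 / 2) (d + 1 / 2)
      - (4 * (n + c + d - 1) : ℂ) •
        wilsonTilde n (a + 1 / 2) (b + 1 / 2) (c - 1 / 2) (d - 1 / 2)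
  | .minus =>
      - (1 / 2 * n * (n + e1 a b c d - 1)) •
        wilsonTilde (n - 1) (a + 1 / 2) (b + 1 / 2) (c + 1 / 2) (d + 1 / 2)
  | .plus =>
      (128 : ℂ) • wilsonTilde (n + 1) (a - 1 / 2) (b - 1 / 2) (c - 1 / 2) (d - 1 / 2)
      + (8 * (6 * alpha a b c d - 1 + 2 * beta a b c d * sigma a b c d) * (n + a + b - 1)) •
        wilsonTilde n (a - 1 / 2) (b - 1 / 2) (c + 1 / 2) (d + 1 / 2)
      + (8 * (6 * alpha a b c d - 1 - 2 * beta a b c d * sigma a b c d) * (n + c + d - 1)) •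
        wilsonTilde n (a + 1 / 2) (b + 1 / 2) (c - 1 / 2) (d - 1 / 2)
      + (8 * ((1 - 6 * alpha a b c d) * (a * b + c * d)
            - 2 * beta a b c d * sigma a b c d * (a * b - c * d) + xi a b c d)
          * n * (n + e1 a b c d - 1)) •
        wilsonTilde (n - 1) (a + 1 / 2) (b + 1 / 2) (c + 1 / 2) (d + 1 / 2)

/-- `genSymbol (e₁ / 2 - 1) g` expanded in products of linear symbols, with the coefficients that
appear in `wilsonAction`. -/
noncomputable def wilsonSymbol (a b c d : ℂ) : Gen → ℂ[X]
  | .zero =>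
      (4 * sigma a b c d) • (linSymbol c * linSymbol d)
      + (4 * sigma a b c d * (a * b - c * d) - e1 a b c d) • 1
      - (4 * sigma a b c d) • (linSymbol a * linSymbol b)
  | .three =>
      - (4 : ℂ) • (linSymbol a * linSymbol b)
      + (1 / 2 * (8 * (a * b + c * d) - e1 a b c d ^ 2 - 1)) • 1
      - (4 : ℂ) • (linSymbol c * linSymbol d)
  | .minus => - (1 / 2 : ℂ) • 1
  | .plus =>
      (128 : ℂ) • (linSymbol a * linSymbol b * linSymbol c * linSymbol d)
      + (8 * (6 * alpha a b c d - 1 + 2 * beta a b c d * sigma a b c d)) •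
        (linSymbol a * linSymbol b)
      + (8 * (6 * alpha a b c d - 1 - 2 * beta a b c d * sigma a b c d)) •
        (linSymbol c * linSymbol d)
      + (8 * ((1 - 6 * alpha a b c d) * (a * b + c * d)
            - 2 * beta a b c d * sigma a b c d * (a * b - c * d) + xi a b c d)) • 1

theorem diffOp_wilsonSymbol_wilsonTilde (n : ℕ) (a b c d : ℂ) (g : Gen) :
    diffOp (wilsonSymbol a b c d g) (wilsonTilde n a b c d) = wilsonAction n a b c d g := by
  cases g <;>
    simp only [wilsonSymbol, wilsonAction, map_add, map_sub, map_smul, map_neg, neg_smul,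
      LinearMap.add_apply, LinearMap.sub_apply, LinearMap.smul_apply, LinearMap.neg_apply,
      diffOp_one_wilsonTilde, diffOp_linSymbol_mul_wilsonTilde_left,
      diffOp_linSymbol_mul_wilsonTilde_right, diffOp_prod_linSymbol_wilsonTilde] <;>
    module

theorem sigma_mul_eval_linSymbol_sub {a b c d : ℂ} (h : a + b ≠ c + d) (x : ℂ) :
    sigma a b c d * ((linSymbol a).eval x * (linSymbol b).eval x
        - (linSymbol c).eval x * (linSymbol d).eval x - (a * b - c * d)) = (x - 1) / 2 := by
  have hσ : sigma a b c d * (a + b - c - d) = 1 :=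
    inv_mul_cancel₀ (by rwa [sub_sub, sub_ne_zero])
  simp only [eval_linSymbol]
  linear_combination (x - 1) / 2 * hσ

theorem wilsonSymbol_eq_genSymbol {a b c d : ℂ} (h : a + b ≠ c + d) (g : Gen) :
    wilsonSymbol a b c d g = genSymbol (e1 a b c d / 2 - 1) g := by
  refine Polynomial.funext fun x => ?_
  have hσ := sigma_mul_eval_linSymbol_sub h x
  cases g <;>
    simp only [wilsonSymbol, genSymbol, eval_add, eval_sub, eval_mul, eval_smul, eval_pow, eval_C,
      eval_X, eval_one, eval_ofNat, smul_eq_mul]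
  case zero => linear_combination -4 * hσ
  case three =>
    simp only [eval_linSymbol, e1]
    ring
  case plus =>
    linear_combination (norm := skip) 16 * beta a b c d * hσ
    simp only [eval_linSymbol, alpha, beta, xi, e1, e2, e3, e4]
    ring
  case minus => ring

theorem forall_gen {p : Gen → Prop} :
    (∀ g, p g) ↔ p .zero ∧ p .three ∧ p .minus ∧ p .plus :=
  ⟨fun h => ⟨h _, h _, h _, h _⟩, fun ⟨h₀, h₃, hm, hp⟩ g => by cases g <;> assumption⟩

end Action

end RationalSklyanin

theorem mainTheorem2_general {a b c d : ℂ} (he : ∀ m : ℕ, a + b + c + d ≠ -m)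
    (hσ : a + b ≠ c + d) :
    (LinearIndependent ℂ (fun n : ℕ => wilsonTilde n a b c d) ∧
      Submodule.span ℂ (Set.range fun n : ℕ => wilsonTilde n a b c d) = ⊤) ∧
    ∃! ρ : SkAlg →ₐ[ℂ] Module.End ℂ (Polynomial ℂ), ∀ (n : ℕ) (g : Gen),
      ρ (S g) (wilsonTilde n a b c d) = wilsonAction n a b c d g := by
  have hact (n : ℕ) (g : Gen) : sklyaninRep (e1 a b c d / 2 - 1) (S g) (wilsonTilde n a b c d)
      = wilsonAction n a b c d g := by
    rw [sklyaninRep_S, ← wilsonSymbol_eq_genSymbol hσ, diffOp_wilsonSymbol_wilsonTilde]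
  have hspan := span_range_wilsonTilde he
  refine ⟨⟨linearIndependent_wilsonTilde he, hspan⟩, sklyaninRep (e1 a b c d / 2 - 1), hact, ?_⟩
  exact fun ρ hρ => algHom_ext_of_S fun g =>
    LinearMap.ext_on_range hspan fun n => (hρ n g).trans (hact n g).symm

theorem mainTheorem2 (a b c d : ℝ) (ha : 0 < a) (hb : 0 < b) (hc : 0 < c) (hd : 0 < d)
    (hσ : a + b ≠ c + d) :
    -- the rescaled Wilson polynomials form a basis of the space of polynomials in `x²`
    (LinearIndependent ℂ (fun n : ℕ => wilsonTilde n a b c d) ∧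
      Submodule.span ℂ (Set.range fun n : ℕ => wilsonTilde n a b c d) = ⊤) ∧
    -- the actions on this basis define a representation
    ∃! ρ : SkAlg →ₐ[ℂ] Module.End ℂ (Polynomial ℂ), ∀ n : ℕ,
      ρ (S .zero) (wilsonTilde n a b c d) =
          (4 * sigma a b c d * (n + c + d - 1)) •
            wilsonTilde n (a + 1/2) (b + 1/2) (c - 1/2) (d - 1/2)
        + ((4 * sigma a b c d * (a * b - c * d) - e1 a b c d) * n * (n + e1 a b c d - 1)) •
            wilsonTilde (n - 1) (a + 1/2) (b + 1/2) (c + 1/2) (d + 1/2)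
        - (4 * sigma a b c d * (n + a + b - 1)) •
            wilsonTilde n (a - 1/2) (b - 1/2) (c + 1/2) (d + 1/2) ∧
      ρ (S .three) (wilsonTilde n a b c d) =
        - (4 * (n + a + b - 1) : ℂ) •
            wilsonTilde n (a - 1/2) (b - 1/2) (c + 1/2) (d + 1/2)
        + (1/2 * (8 * (a * b + c * d) - e1 a b c d ^ 2 - 1) * n * (n + e1 a b c d - 1)) •
            wilsonTilde (n - 1) (a + 1/2) (b + 1/2) (c + 1/2) (d + 1/2)
        - (4 * (n + c + d - 1) : ℂ) •
            wilsonTilde n (a + 1/2) (b + 1/2) (c - 1/2) (d - 1/2) ∧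
      ρ (S .minus) (wilsonTilde n a b c d) =
        - (1/2 * n * (n + e1 a b c d - 1)) •
            wilsonTilde (n - 1) (a + 1/2) (b + 1/2) (c + 1/2) (d + 1/2) ∧
      ρ (S .plus) (wilsonTilde n a b c d) =
          (128 : ℂ) • wilsonTilde (n + 1) (a - 1/2) (b - 1/2) (c - 1/2) (d - 1/2)
        + (8 * (6 * alpha a b c d - 1 + 2 * beta a b c d * sigma a b c d) * (n + a + b - 1)) •
            wilsonTilde n (a - 1/2) (b - 1/2) (c + 1/2) (d + 1/2)
        + (8 * (6 * alpha a b c d - 1 - 2 * beta a b c d * sigma a b c d) * (n + c + d - 1)) •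
            wilsonTilde n (a + 1/2) (b + 1/2) (c - 1/2) (d - 1/2)
        + (8 * ((1 - 6 * alpha a b c d) * (a * b + c * d)
              - 2 * beta a b c d * sigma a b c d * (a * b - c * d) + xi a b c d)
            * n * (n + e1 a b c d - 1)) •
            wilsonTilde (n - 1) (a + 1/2) (b + 1/2) (c + 1/2) (d + 1/2) := by
  have he (m : ℕ) : (a + b + c + d : ℂ) ≠ -m := by
    have hlt : -(m : ℝ) < a + b + c + d := (neg_nonpos.mpr m.cast_nonneg).trans_lt (by positivity)
    exact_mod_cast hlt.ne'
  simpa only [forall_gen, wilsonAction] using mainTheorem2_general he (by exact_mod_cast hσ)
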